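/- Let $q$ be a prime power, let $m,t>1$ be integers, and let $A_1,\dots,A_t$ be nonempty pairwise disjoint subsets of $[m]=\{1,\dots,m\}$. Represent the points of $PG(m-1,q)$ by the vectors of $\mathbb{F}_q^m$ whose first nonzero coordinate is $1$. For $A\subseteq[m]$ let $P_A$ be the set of points whose coordinates outside $A$ vanish, put $D=\bigcup_{i=1}^t P_{A_i}$ and $D^c=PG(m-1,q)\setminus D$, and let $$C_{D^c}=\{(\mathbf{x}\cdot\mathbf{d})_{\mathbf{d}\in D^c}:\mathbf{x}\in\mathbb{F}_q^m\},$$ a linear code over $\mathbb{F}_q$ of length $|D^c|$. A linear code $C$ of length $n$ is an $(r,\delta)$-LRC if every coordinate $i$ lies in a set $R_i$ of at most $r+\delta-1$ coordinates such that the restriction $C|_{R_i}$ has minimum distance at least $\delta$. Let $k_{opt}^{(q)}(n,d)$ be the maximum dimension of a $q$-ary linear code of length $n$ and minimum distance $d$ (and $0$ if there is no such code, in particular if $n<d$). An $(r,\delta)$-LRC with length $n$, dimension $k$ and minimum distance $d$ is called $k$-optimal if it attains the generalized Cadambe--Mazumdar bound, i.e. $$k=\min_{s\ge 1}\{sr+k_{opt}^{(q)}(n-s(r+\delta-1),d)\}.$$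 Then: 1. If $t=2$ and $|A_i|\le m-2$ for $i=1,2$, then $C_{D^c}$ is a $k$-optimal $(2,q)$-LRC. 2. If $t\ge 3$, $m\ge 4$, and for every integer $a$ at most $q-1$ of the sets $A_1,\dots,A_t$ have cardinality $a$, then $C_{D^c}$ is a $k$-optimal $(2,q)$-LRC. 3. If $m>t=2$, $q>2$ and one of $A_1,A_2$ has cardinality $m-1$, then $C_{D^c}$ is a $k$-optimal $(2,q-1)$-LRC. -/

import Mathlib

/-- The minimum (Hamming) distance of a linear code with coordinates indexed by `ι`.
It is `⊤` exactly when the code has no two distinct codewords, i.e. for the zero code. -/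
noncomputable def minDist {F ι : Type*} [Field F] [DecidableEq F] [Fintype ι]
    (C : Submodule F (ι → F)) : ℕ∞ :=
  ⨅ x ∈ C, ⨅ y ∈ C, ⨅ _ : x ≠ y, (hammingDist x y : ℕ∞)

/-- The code `C|_R`: codewords of `C` restricted to the coordinates in `R`
(puncturing `C` on the complement of `R`). -/
def restrictCode {F ι : Type*} [Field F] (C : Submodule F (ι → F)) (R : Finset ι) :
    Submodule F (R → F) :=
  C.map (LinearMap.funLeft F F (Subtype.val : R → ι))

/-- `C` is an `(r, δ)`-LRC: every coordinate `i` lies in a set `R` of at most `r + δ - 1`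
coordinates such that `C|_R` has minimum distance at least `δ`. -/
def IsLRC {F ι : Type*} [Field F] [DecidableEq F] [Fintype ι]
    (r δ : ℕ) (C : Submodule F (ι → F)) : Prop :=
  ∀ i : ι, ∃ R : Finset ι, i ∈ R ∧ R.card ≤ r + δ - 1 ∧ (δ : ℕ∞) ≤ minDist (restrictCode C R)

/-- `k_opt(n, d)`: the maximum dimension of a linear code over `F` of length `n` and minimum
distance `d`. The set is bounded by `n`; the value is `0` if there is no such code. -/
noncomputable def kOpt (F : Type*) [Field F] [DecidableEq F] (n : ℕ) (d : ℕ∞) : ℕ :=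
  sSup {k : ℕ | ∃ C : Submodule F (Fin n → F), minDist C = d ∧ Module.finrank F C = k}

/-- The generalized Cadambe–Mazumdar bound
`min_{s ≥ 1} (s r + k_opt(n - s (r + δ - 1), d))`.
When `s (r + δ - 1) > n` the truncated length is `0`, where `k_opt` vanishes as it should. -/
noncomputable def cadambeMazumdarBound (F : Type*) [Field F] [DecidableEq F]
    (r δ n : ℕ) (d : ℕ∞) : ℕ :=
  sInf {b : ℕ | ∃ s : ℕ, 1 ≤ s ∧ b = s * r + kOpt F (n - s * (r + δ - 1)) d}

/-- `C` is a `k`-optimal `(r, δ)`-LRC: it is an `(r, δ)`-LRC and its dimension attains the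
generalized Cadambe–Mazumdar bound for its own length and minimum distance. -/
def IsKOptimalLRC {F ι : Type*} [Field F] [DecidableEq F] [Fintype ι]
    (r δ : ℕ) (C : Submodule F (ι → F)) : Prop :=
  IsLRC r δ C ∧
    Module.finrank F C = cadambeMazumdarBound F r δ (Fintype.card ι) (minDist C)

/-- The points of `PG(m-1, q)`, represented by the vectors of `F ^ m` whose first nonzero
coordinate is `1`. -/
def projPoints (F : Type*) [Field F] [Fintype F] [DecidableEq F] (m : ℕ) :
    Finset (Fin m → F) :=
  Finset.univ.filter fun v => ∃ i, v i = 1 ∧ ∀ j, j < i → v j = 0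

/-- `P_A`: the points of `PG(m-1, q)` whose coordinates outside `A` are `0`. -/
def subPoints (F : Type*) [Field F] [Fintype F] [DecidableEq F] {m : ℕ}
    (A : Finset (Fin m)) : Finset (Fin m → F) :=
  (projPoints F m).filter fun v => ∀ j, j ∉ A → v j = 0

/-- The linear map `x ↦ (x · d)_{d ∈ D}`. -/
def dotMap {F : Type*} [Field F] {m : ℕ} (D : Finset (Fin m → F)) :
    (Fin m → F) →ₗ[F] (D → F) where
  toFun x := fun d => x ⬝ᵥ d.1
  map_add' x y := by
    funext d
    exact add_dotProduct x y d.1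
  map_smul' a x := by
    funext d
    exact smul_dotProduct a x d.1

/-- The code `C_D = {(x · d)_{d ∈ D} : x ∈ F ^ m}`, with coordinates indexed by `D`. -/
def codeOf {F : Type*} [Field F] {m : ℕ} (D : Finset (Fin m → F)) : Submodule F (D → F) :=
  LinearMap.range (dotMap D)

/-- `D^c`, the complement in `PG(m-1, q)` of `D = ⋃ i, P_{A i}`. -/
def complPoints (F : Type*) [Field F] [Fintype F] [DecidableEq F] {m t : ℕ}
    (A : Fin t → Finset (Fin m)) : Finset (Fin m → F) :=
  projPoints F m \ Finset.univ.biUnion fun i => subPoints F (A i)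

/-!
Write `q = |F|`, `a_i = |A i|` and `n = |D^c|`.

*Parameters.* A functional that does not vanish on a subspace of dimension `a` is nonzero at
`q ^ (a - 1)` of its points, so the codeword of `x ≠ 0` has weight `q ^ (m - 1)` minus the sum of
`q ^ (a_i - 1)` over those `i` for which `A i` meets the support of `x`
(`hammingNorm_dotMap_complPoints_add`). Hence the dimension is `m` and the minimum distance is
`d = q ^ (m - 1) - ∑ i, q ^ (a_i - 1)`, attained at `x = (1, …, 1)`.

*Locality.* On the points of a line a codeword is zero or vanishes at most once
(`exists_repair_set`). In the first two cases counting gives, for each `p ∈ D^c`, a line through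
`p` that misses `D` (`isLRC_complPoints_of_sum_lt`). In the third case there is a line through `p`
that meets `D` in a single point (`isLRC_complPoints_of_hyperplane`).

*Optimality.* The generalized Cadambe–Mazumdar bound holds for every LRC (`IsLRC.finrank_le`): the
coordinates of `s` repair sets, suitably enlarged to `s (r + δ - 1)` coordinates, have rank at most
`s r`, and shortening at them leaves a code of minimum distance at least `d`, which can be lowered
to `d` by erasing coordinates of a word of least weight. So it suffices to find one `s` for which
the bound is no more than `m`, and `s = 1` will do: by the Griesmer bound (`griesmer_bound`) a code
of dimension `m - 1` and minimum distance `d` has length at least `∑ j < m - 1, ⌈d / q ^ j⌉`. If no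
value occurs more than `q - 1` times among the `a_i`, then `∑ i, q ^ (a_i - 1)` has the expected
base-`q` digits and this sum is `n - 1`; for `t = 2` it is at least `n - 2` in any case. Since
`r + δ - 1 ≥ 3`, the code left after removing one repair set has dimension at most `m - 2`.
-/

/-! ### Minimum distance and weights -/

theorem le_minDist_iff {F ι : Type*} [Field F] [DecidableEq F] [Fintype ι]
    {C : Submodule F (ι → F)} {d : ℕ} :
    (d : ℕ∞) ≤ minDist C ↔ ∀ c ∈ C, c ≠ 0 → d ≤ hammingNorm c := by
  simp only [minDist, le_iInf_iff, Nat.cast_le]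
  constructor
  · intro h c hc hc0
    simpa using h c hc 0 C.zero_mem hc0
  · intro h x hx y hy hxy
    rw [hammingDist_eq_hammingNorm, neg_add_eq_sub]
    exact h _ (C.sub_mem hy hx) (sub_ne_zero.2 hxy.symm)

theorem minDist_le_hammingNorm {F ι : Type*} [Field F] [DecidableEq F] [Fintype ι]
    {C : Submodule F (ι → F)} {c : ι → F} (hc : c ∈ C) (hc0 : c ≠ 0) :
    minDist C ≤ hammingNorm c := by
  have h : minDist C ≤ hammingDist c 0 :=
    iInf₂_le_of_le c hc (iInf₂_le_of_le 0 C.zero_mem (iInf_le _ hc0))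
  simpa using h

theorem minDist_eq_of_forall_le {F ι : Type*} [Field F] [DecidableEq F] [Fintype ι]
    {C : Submodule F (ι → F)} {d : ℕ} (h : ∀ c ∈ C, c ≠ 0 → d ≤ hammingNorm c)
    {c : ι → F} (hc : c ∈ C) (hc0 : c ≠ 0) (hd : hammingNorm c = d) : minDist C = d :=
  le_antisymm (hd ▸ minDist_le_hammingNorm hc hc0) (le_minDist_iff.2 h)

/-! ### Subcodes vanishing on a set of coordinates -/

/-- `C(I)`: the codewords of `C` that vanish on the coordinates in `I`. Puncturing it on `I`
gives the code `C` shortened at `I`. -/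
def vanishOn {F ι : Type*} [Field F] (C : Submodule F (ι → F)) (I : Finset ι) :
    Submodule F (ι → F) where
  carrier := {c | c ∈ C ∧ ∀ i ∈ I, c i = 0}
  add_mem' := fun ha hb => ⟨C.add_mem ha.1 hb.1, fun i hi => by simp [ha.2 i hi, hb.2 i hi]⟩
  zero_mem' := ⟨C.zero_mem, fun _ _ => rfl⟩
  smul_mem' := fun a _ hc => ⟨C.smul_mem a hc.1, fun i hi => by simp [hc.2 i hi]⟩

theorem mem_vanishOn {F ι : Type*} [Field F] {C : Submodule F (ι → F)} {I : Finset ι}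
    {c : ι → F} : c ∈ vanishOn C I ↔ c ∈ C ∧ ∀ i ∈ I, c i = 0 := Iff.rfl

theorem finrank_vanishOn_le {F ι : Type*} [Field F] [Fintype ι] [DecidableEq ι]
    (C : Submodule F (ι → F)) (I S : Finset ι) :
    Module.finrank F (vanishOn C I) ≤ Module.finrank F (vanishOn C (I ∪ S)) + S.card := by
  let f : vanishOn C I →ₗ[F] (S → F) :=
    (LinearMap.funLeft F F (Subtype.val : S → ι)).comp (vanishOn C I).subtype
  have hker : (LinearMap.ker f).map (vanishOn C I).subtype = vanishOn C (I ∪ S) := by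
    ext c
    simp only [Submodule.mem_map, LinearMap.mem_ker, Submodule.subtype_apply, Subtype.exists,
      mem_vanishOn, Finset.mem_union]
    constructor
    · rintro ⟨c, hc, h, rfl⟩
      refine ⟨hc.1, fun i hi => hi.elim (hc.2 i) fun hi => ?_⟩
      exact congrFun h ⟨i, hi⟩
    · rintro ⟨hc, h⟩
      exact ⟨c, ⟨hc, fun i hi => h i (.inl hi)⟩, funext fun i => h i (.inr i.2), rfl⟩
  have h1 := LinearMap.finrank_range_add_finrank_ker f
  have h2 : Module.finrank F (LinearMap.range f) ≤ S.card := by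
    simpa using Submodule.finrank_le (LinearMap.range f)
  have h3 : Module.finrank F (LinearMap.ker f) = Module.finrank F (vanishOn C (I ∪ S)) := by
    rw [← hker]
    exact (LinearEquiv.finrank_eq (Submodule.equivMapOfInjective _
      (vanishOn C I).injective_subtype _))
  omega

theorem exists_minimal_weight {F ι : Type*} [Field F] {W : Submodule F (ι → F)} (hW : W ≠ ⊥)
    (wt : (ι → F) → ℕ) : ∃ v ∈ W, v ≠ 0 ∧ ∀ c ∈ W, c ≠ 0 → wt v ≤ wt c := by
  obtain ⟨v, hv, hv0⟩ := Submodule.exists_mem_ne_zero_of_ne_bot hW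
  have hne : (wt '' {c | c ∈ W ∧ c ≠ 0}).Nonempty := ⟨_, v, ⟨hv, hv0⟩, rfl⟩
  obtain ⟨u, hu, h⟩ := Nat.sInf_mem hne
  exact ⟨u, hu.1, hu.2, fun c hc hc0 => h ▸ Nat.sInf_le ⟨c, ⟨hc, hc0⟩, rfl⟩⟩

/-! ### The Griesmer bound -/

/-- The averaging step behind the residual code: if no `u - a v` has weight less than `v`, then
outside the support of `v` the word `u` has at least a `1/q` share of the weight of `v`. -/
theorem card_support_le_mul_card_residual {F ι : Type*} [Field F] [Fintype F] [DecidableEq F]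
    (S : Finset ι) (u v : ι → F)
    (h : ∀ a : F, (S.filter fun i => v i ≠ 0).card ≤ (S.filter fun i => (u - a • v) i ≠ 0).card) :
    (S.filter fun i => v i ≠ 0).card ≤
      Fintype.card F * ((S.filter fun i => v i = 0).filter fun i => u i ≠ 0).card := by
  classical
  have h1 := Finset.card_nsmul_le_sum (Finset.univ : Finset F) _ _ fun a _ => h a
  simp only [Finset.card_filter (fun i => (u - _ • v) i ≠ 0)] at h1
  rw [Finset.sum_comm] at h1
  have h2 : ∀ i ∈ S, (∑ a : F, if (u - a • v) i ≠ 0 then 1 else 0) =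
      (if v i ≠ 0 then Fintype.card F - 1 else 0) +
        (if v i = 0 ∧ u i ≠ 0 then Fintype.card F else 0) := by
    intro i _
    by_cases hv : v i = 0
    · by_cases hu : u i = 0 <;> simp [hv, hu]
    · have : (Finset.univ.filter fun a : F => (u - a • v) i ≠ 0) =
          Finset.univ.erase (u i / v i) := by
        ext a
        simp [sub_eq_zero, eq_div_iff hv, eq_comm]
      rw [← Finset.card_filter, this]
      simp [hv, Finset.card_erase_of_mem]
  rw [Finset.sum_congr rfl h2, Finset.sum_add_distrib, ← Finset.sum_filter, ← Finset.sum_filter,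
    Finset.sum_const, Finset.sum_const, ← Finset.filter_filter] at h1
  simp only [Finset.card_univ, smul_eq_mul] at h1
  obtain ⟨n, hn⟩ : ∃ n, Fintype.card F = n + 1 := ⟨_, (Nat.succ_pred Fintype.card_ne_zero).symm⟩
  rw [hn] at h1 ⊢
  simp only [Nat.add_sub_cancel] at h1
  nlinarith

/-- The Griesmer bound `∑ j < k, ⌈d / q ^ j⌉ ≤ n` for the restriction of a code to the
coordinates in `S`. The hypothesis on `e` says `e j ≤ ⌈d / q ^ j⌉`. -/
theorem griesmer_bound {F ι : Type*} [Field F] [Fintype F] [DecidableEq F] [Fintype ι]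
    (k : ℕ) : ∀ (W : Submodule F (ι → F)) (S : Finset ι) (d : ℕ) (e : ℕ → ℤ),
    k ≤ Module.finrank F W →
    (∀ c ∈ W, c ≠ 0 → d ≤ (S.filter fun i => c i ≠ 0).card) →
    (∀ j < k, (Fintype.card F : ℤ) ^ j * e j < d + (Fintype.card F : ℤ) ^ j) →
    ∑ j ∈ Finset.range k, e j ≤ S.card := by
  classical
  have hq : 0 < Fintype.card F := Fintype.card_pos
  induction k with
  | zero => intro W S d e _ _ _; simp
  | succ k ih =>
    intro W S d e hk hd he
    have hW : W ≠ ⊥ := by rintro rfl; simp at hk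
    have he0 : e 0 ≤ d := by have := he 0 (by omega); simp at this; omega
    -- A word of least weight on `S`; if this weight is zero, so is `d`, and no `e j` is positive.
    obtain ⟨v, hv, hv0, hmin⟩ := exists_minimal_weight hW fun c => (S.filter fun i => c i ≠ 0).card
    have hdv := hd v hv hv0
    by_cases hw : (S.filter fun i => v i ≠ 0) = ∅
    · have hd0 : d = 0 := by simpa [hw] using hdv
      have : ∑ j ∈ Finset.range (k + 1), e j ≤ 0 := by
        refine Finset.sum_nonpos fun j hj => ?_
        have h := he j (Finset.mem_range.1 hj)
        have hqj : (0 : ℤ) < (Fintype.card F : ℤ) ^ j := by positivity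
        rw [hd0, Nat.cast_zero, zero_add] at h
        by_contra! hc
        nlinarith
      exact this.trans (by positivity)
    · obtain ⟨i₀, hi₀⟩ := Finset.nonempty_iff_ne_empty.2 hw
      have hvi₀ : v i₀ ≠ 0 := (Finset.mem_filter.1 hi₀).2
      -- The words of `W` that vanish at a coordinate `i₀` of the support of `v` form a complement
      -- of the line spanned by `v`, and the induction runs on them, off the support of `v`.
      set w := (S.filter fun i => v i ≠ 0).card with hwdef
      have hres : ∀ c ∈ vanishOn W {i₀}, c ≠ 0 →
          (w + Fintype.card F - 1) / Fintype.card F ≤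
            ((S.filter fun i => v i = 0).filter fun i => c i ≠ 0).card := by
        intro c hc hc0
        have := card_support_le_mul_card_residual S c v fun a => by
          refine hmin _ (W.sub_mem hc.1 (W.smul_mem a hv)) fun h0 => hc0 ?_
          have h1 := congrFun h0 i₀
          simp [hc.2 i₀ (by simp), hvi₀] at h1
          simpa [h1] using h0
        rw [Nat.div_le_iff_le_mul_add_pred hq]
        omega
      have hdim := finrank_vanishOn_le W ∅ {i₀}
      have hWe : vanishOn W ∅ = W := by ext c; simp [mem_vanishOn]
      rw [hWe, Finset.empty_union, Finset.card_singleton] at hdim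
      have hceil : d ≤ Fintype.card F * ((w + Fintype.card F - 1) / Fintype.card F) := by
        have h1 := Nat.div_add_mod (w + Fintype.card F - 1) (Fintype.card F)
        have h2 := Nat.mod_lt (w + Fintype.card F - 1) hq
        omega
      have := ih (vanishOn W {i₀}) (S.filter fun i => v i = 0) _ (fun j => e (j + 1)) (by omega)
        hres fun j hj => by
          have h := he (j + 1) (by omega)
          have hceil' : (d : ℤ) ≤ Fintype.card F *
            (((w + Fintype.card F - 1) / Fintype.card F : ℕ) : ℤ) := by exact_mod_cast hceil
          have hq' : (0 : ℤ) < Fintype.card F := by exact_mod_cast hq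
          refine lt_of_mul_lt_mul_left ?_ hq'.le
          rw [pow_succ] at h
          linarith
      have hcard : w + (S.filter fun i => v i = 0).card = S.card := by
        rw [hwdef, add_comm]
        exact Finset.card_filter_add_card_filter_not _
      rw [Finset.sum_range_succ']
      have : (d : ℤ) ≤ w := by exact_mod_cast hdv
      omega

/-! ### The generalized Cadambe–Mazumdar bound -/

/-- Erasing `w - d` coordinates of the support of a word of least weight `w` lowers the minimum
distance to exactly `d`. -/
theorem exists_minDist_eq {F ι : Type*} [Field F] [DecidableEq F] [Fintype ι]
    {C : Submodule F (ι → F)} (hC : C ≠ ⊥) {d : ℕ} (hd0 : 0 < d)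
    (hd : ∀ c ∈ C, c ≠ 0 → d ≤ hammingNorm c) :
    ∃ C' : Submodule F (ι → F), minDist C' = d ∧ Module.finrank F C' = Module.finrank F C := by
  classical
  obtain ⟨v, hv, hv0, hmin⟩ := exists_minimal_weight hC hammingNorm
  have hvd := hd v hv hv0
  obtain ⟨T, hTs, hT⟩ := Finset.exists_subset_card_eq
    (show hammingNorm v - d ≤ (Finset.univ.filter fun i => v i ≠ 0).card from Nat.sub_le _ _)
  let f : (ι → F) →ₗ[F] (ι → F) :=
    LinearMap.pi fun i => if i ∈ T then 0 else LinearMap.proj i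
  have hf : ∀ c i, f c i = if i ∈ T then 0 else c i := by
    intro c i; by_cases hi : i ∈ T <;> simp [f, hi]
  have hsupp : ∀ c, (Finset.univ.filter fun i => f c i ≠ 0) =
      (Finset.univ.filter fun i => c i ≠ 0) \ T := by
    intro c; ext i; by_cases hi : i ∈ T <;> simp [hf, hi]
  have hnorm : ∀ c ∈ C, c ≠ 0 → d ≤ hammingNorm (f c) := by
    intro c hc hc0
    have h1 := hmin c hc hc0
    have h2 := Finset.le_card_sdiff T (Finset.univ.filter fun i => c i ≠ 0)
    rw [← hsupp] at h2
    unfold hammingNorm at *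
    omega
  have hinj : ∀ c ∈ C, f c = 0 → c = 0 := by
    intro c hc h0
    by_contra hc0
    have := hnorm c hc hc0
    rw [h0, hammingNorm_zero] at this
    omega
  refine ⟨C.map f, minDist_eq_of_forall_le ?_ (Submodule.mem_map_of_mem hv)
    (fun h => hv0 (hinj v hv h)) ?_, ?_⟩
  · rintro _ ⟨c, hc, rfl⟩ h0
    exact hnorm c hc fun h => h0 (by simp [h])
  · have h2 := Finset.card_sdiff_of_subset hTs
    rw [← hsupp] at h2
    unfold hammingNorm at *
    omega
  · have : Function.Injective (f.domRestrict C) := by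
      rw [injective_iff_map_eq_zero]
      intro c hc
      exact Subtype.ext (hinj c c.2 hc)
    rw [← LinearMap.finrank_range_of_inj this, LinearMap.range_domRestrict]

theorem bddAbove_kOpt_set {F : Type*} [Field F] [DecidableEq F] (n : ℕ) (d : ℕ∞) :
    BddAbove {k : ℕ | ∃ C : Submodule F (Fin n → F), minDist C = d ∧ Module.finrank F C = k} := by
  refine ⟨n, ?_⟩
  rintro k ⟨C, -, rfl⟩
  simpa using Submodule.finrank_le C

/-- Shortening at `I` gives a code of length `n - |I|` whose minimum distance is no smaller. -/
theorem finrank_vanishOn_le_kOpt {F ι : Type*} [Field F] [DecidableEq F] [Fintype ι]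
    {C : Submodule F (ι → F)} {d : ℕ} (hd0 : 0 < d) (hd : minDist C = d) (I : Finset ι) :
    Module.finrank F (vanishOn C I) ≤ kOpt F (Fintype.card ι - I.card) d := by
  classical
  by_cases hbot : vanishOn C I = ⊥
  · rw [hbot, finrank_bot]
    exact Nat.zero_le _
  have e : Fin (Fintype.card ι - I.card) ≃ {i // i ∉ I} :=
    (Fintype.equivFinOfCardEq (by simp [Fintype.card_subtype_compl])).symm
  let f : (ι → F) →ₗ[F] (Fin (Fintype.card ι - I.card) → F) :=
    LinearMap.funLeft F F fun j => (e j : ι)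
  have hf : ∀ c j, f c j = c (e j) := fun _ _ => rfl
  have hnorm : ∀ c ∈ vanishOn C I, hammingNorm (f c) = hammingNorm c := by
    intro c hc
    refine Finset.card_bij (fun j _ => (e j : ι)) ?_ ?_ ?_
    · intro j hj; simpa [hf] using hj
    · intro j _ j' _ h; exact e.injective (Subtype.ext h)
    · intro i hi
      have hiI : i ∉ I := fun h => (Finset.mem_filter.1 hi).2 (hc.2 i h)
      exact ⟨e.symm ⟨i, hiI⟩, by simpa [hf] using hi, by simp⟩
  have hinj : Function.Injective (f.domRestrict (vanishOn C I)) := by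
    rw [injective_iff_map_eq_zero]
    intro c hc
    have h1 : f c = 0 := hc
    have h2 := hnorm c c.2
    rw [h1, hammingNorm_zero, eq_comm, hammingNorm_eq_zero] at h2
    exact Subtype.ext h2
  have hrank : Module.finrank F ((vanishOn C I).map f) = Module.finrank F (vanishOn C I) := by
    rw [← LinearMap.finrank_range_of_inj hinj, LinearMap.range_domRestrict]
  have hne : (vanishOn C I).map f ≠ ⊥ := by
    intro h
    rw [h, finrank_bot, eq_comm, Submodule.finrank_eq_zero] at hrank
    exact hbot hrank
  obtain ⟨C', h1, h2⟩ := exists_minDist_eq hne hd0 (by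
    rintro _ ⟨c, hc, rfl⟩ h0
    rw [hnorm c hc]
    exact le_minDist_iff.1 hd.ge c hc.1 fun h => h0 (by simp [h]))
  exact le_csSup (bddAbove_kOpt_set _ _) ⟨C', h1, h2.trans hrank⟩

/-- One more repair set: it is enlarged to `r + δ - 1` new coordinates, on which `C(I)` has rank
at most `r` because the last `δ - 1` coordinates of a repair set are determined by the others. -/
theorem IsLRC.exists_card_add_le {F ι : Type*} [Field F] [DecidableEq F] [Fintype ι]
    {r δ : ℕ} (hδ : 0 < δ) {C : Submodule F (ι → F)} (hC : IsLRC r δ C) (I : Finset ι)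
    (hI : r < Module.finrank F (vanishOn C I)) :
    ∃ J : Finset ι, I.card + (r + δ - 1) ≤ J.card ∧
      Module.finrank F (vanishOn C I) ≤ Module.finrank F (vanishOn C J) + r := by
  classical
  have hbot : vanishOn C I ≠ ⊥ := by
    intro h; rw [h, finrank_bot] at hI; omega
  obtain ⟨c, hc, hc0⟩ := Submodule.exists_mem_ne_zero_of_ne_bot hbot
  obtain ⟨i, hi⟩ := Function.ne_iff.1 hc0
  obtain ⟨R, hiR, hRcard, hR⟩ := hC i
  have hweight : ∀ c ∈ C, (∃ i ∈ R, c i ≠ 0) → δ ≤ (R.filter fun i => c i ≠ 0).card := by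
    rintro c hc ⟨i, hi, hci⟩
    have := le_minDist_iff.1 hR (fun j : R => c j) ⟨c, hc, rfl⟩
      fun h => hci (congrFun h ⟨i, hi⟩)
    refine this.trans_eq ?_
    refine Finset.card_bij (fun j _ => (j : ι)) ?_ ?_ ?_
    · intro j hj; simpa using hj
    · intro j _ j' _ h; exact Subtype.ext h
    · intro j hj
      have hj' := Finset.mem_filter.1 hj
      exact ⟨⟨j, hj'.1⟩, by simpa using hj'.2, rfl⟩
  have hT : δ ≤ (R \ I).card := by
    refine (hweight c hc.1 ⟨i, hiR, hi⟩).trans (Finset.card_le_card fun j hj => ?_)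
    have hj' := Finset.mem_filter.1 hj
    exact Finset.mem_sdiff.2 ⟨hj'.1, fun h => hj'.2 (hc.2 j h)⟩
  have hTR : (R \ I).card ≤ r + δ - 1 := (Finset.card_le_card Finset.sdiff_subset).trans hRcard
  obtain ⟨T, hTs, hTc⟩ := Finset.exists_subset_card_eq
    (show (R \ I).card - (δ - 1) ≤ (R \ I).card from Nat.sub_le _ _)
  -- Off `I ∪ T` the repair set has fewer than `δ` coordinates, too few for a nonzero word.
  have key : ∀ S : Finset ι, vanishOn C (I ∪ (T ∪ S)) = vanishOn C (I ∪ R ∪ S) := by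
    intro S
    ext c
    simp only [mem_vanishOn, Finset.mem_union]
    refine and_congr_right fun hc => ⟨fun h => ?_, fun h j hj => h j ?_⟩
    · have hRz : ∀ j ∈ R, c j = 0 := by
        by_contra! hcon
        have h1 := hweight c hc hcon
        have h2 : (R.filter fun i => c i ≠ 0) ⊆ (R \ I) \ T := by
          intro j hj
          have hj' := Finset.mem_filter.1 hj
          simp only [Finset.mem_sdiff]
          exact ⟨⟨hj'.1, fun hI => hj'.2 (h j (.inl hI))⟩, fun hT => hj'.2 (h j (.inr (.inl hT)))⟩
        have h3 := Finset.card_le_card h2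
        rw [Finset.card_sdiff_of_subset hTs] at h3
        omega
      rintro j ((hj | hj) | hj)
      exacts [h j (.inl hj), hRz j hj, h j (.inr (.inr hj))]
    · rcases hj with hj | hj | hj
      exacts [.inl (.inl hj), .inl (.inr (Finset.mem_sdiff.1 (hTs hj)).1), .inr hj]
  have hIR : (I ∪ R).card = I.card + (R \ I).card := by
    rw [← Finset.union_sdiff_self_eq_union, Finset.card_union_of_disjoint Finset.disjoint_sdiff]
  -- There is room for the padding, for otherwise `C(I)` would have rank at most `r`.
  have hroom : r - T.card ≤ (I ∪ R)ᶜ.card := by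
    by_contra! hlt
    have h1 := finrank_vanishOn_le C I (T ∪ (I ∪ R)ᶜ)
    have h2 : vanishOn C (I ∪ (T ∪ (I ∪ R)ᶜ)) = ⊥ := by
      rw [key, Finset.union_compl, Submodule.eq_bot_iff]
      exact fun c hc => funext fun i => hc.2 i (Finset.mem_univ i)
    rw [h2, finrank_bot] at h1
    have h3 := Finset.card_union_le T (I ∪ R)ᶜ
    omega
  obtain ⟨S, hSs, hSc⟩ := Finset.exists_subset_card_eq hroom
  refine ⟨I ∪ R ∪ S, ?_, ?_⟩
  · rw [Finset.card_union_of_disjoint (Finset.disjoint_left.2 fun j hj hS =>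
      Finset.mem_compl.1 (hSs hS) hj)]
    omega
  · have h1 := finrank_vanishOn_le C I (T ∪ S)
    have h3 := Finset.card_union_le T S
    rw [key] at h1
    omega

theorem IsLRC.exists_vanishOn {F ι : Type*} [Field F] [DecidableEq F] [Fintype ι]
    {r δ : ℕ} (hδ : 0 < δ) {C : Submodule F (ι → F)} (hC : IsLRC r δ C) (s : ℕ)
    (hs : s * r < Module.finrank F C) :
    ∃ I : Finset ι, s * (r + δ - 1) ≤ I.card ∧
      Module.finrank F C ≤ Module.finrank F (vanishOn C I) + s * r := by
  induction s with
  | zero =>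
    have : vanishOn C ∅ = C := by ext c; simp [mem_vanishOn]
    exact ⟨∅, by simp, by rw [this]; omega⟩
  | succ s ih =>
    rw [Nat.succ_mul] at hs
    obtain ⟨I, h1, h2⟩ := ih (by omega)
    obtain ⟨J, h3, h4⟩ := hC.exists_card_add_le hδ I (by omega)
    refine ⟨J, ?_, ?_⟩ <;> rw [Nat.succ_mul] <;> omega

/-- The generalized Cadambe–Mazumdar bound, for each number `s` of repair sets. -/
theorem IsLRC.finrank_le {F ι : Type*} [Field F] [DecidableEq F] [Fintype ι]
    {r δ : ℕ} (hδ : 0 < δ) {C : Submodule F (ι → F)} (hC : IsLRC r δ C)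
    {d : ℕ} (hd0 : 0 < d) (hd : minDist C = d) (s : ℕ) :
    Module.finrank F C ≤ s * r + kOpt F (Fintype.card ι - s * (r + δ - 1)) d := by
  by_cases hs : s * r < Module.finrank F C
  · obtain ⟨I, h1, h2⟩ := hC.exists_vanishOn hδ s hs
    obtain ⟨J, hJI, hJ⟩ := Finset.exists_subset_card_eq h1
    have h3 : vanishOn C I ≤ vanishOn C J := fun c hc => ⟨hc.1, fun i hi => hc.2 i (hJI hi)⟩
    have h4 := Submodule.finrank_mono h3
    have h5 := finrank_vanishOn_le_kOpt hd0 hd J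
    rw [hJ] at h5
    omega
  · omega

theorem isKOptimalLRC_of_kOpt_le {F ι : Type*} [Field F] [DecidableEq F] [Fintype ι]
    {r δ : ℕ} (hδ : 0 < δ) {C : Submodule F (ι → F)} (hC : IsLRC r δ C)
    {d : ℕ} (hd0 : 0 < d) (hd : minDist C = d)
    (h : r + kOpt F (Fintype.card ι - (r + δ - 1)) d ≤ Module.finrank F C) :
    IsKOptimalLRC r δ C := by
  refine ⟨hC, le_antisymm ?_ ?_⟩
  · rw [cadambeMazumdarBound, hd]
    refine le_csInf ⟨_, 1, le_rfl, rfl⟩ ?_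
    rintro b ⟨s, -, rfl⟩
    exact hC.finrank_le hδ hd0 hd s
  · rw [cadambeMazumdarBound, hd]
    refine le_trans (Nat.sInf_le ⟨1, le_rfl, rfl⟩) ?_
    rwa [one_mul, one_mul]

/-! ### Points of projective space and coordinate subspaces -/

theorem exists_smul_mem_projPoints {F : Type*} [Field F] [Fintype F] [DecidableEq F] {m : ℕ}
    {v : Fin m → F} (hv : v ≠ 0) : ∃ c : F, c ≠ 0 ∧ c • v ∈ projPoints F m := by
  have hne : (Finset.univ.filter fun i => v i ≠ 0).Nonempty := by
    obtain ⟨i, hi⟩ := Function.ne_iff.1 hv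
    exact ⟨i, by simpa using hi⟩
  have hi : v ((Finset.univ.filter fun i => v i ≠ 0).min' hne) ≠ 0 :=
    (Finset.mem_filter.1 (Finset.min'_mem _ hne)).2
  refine ⟨_, inv_ne_zero hi, Finset.mem_filter.2 ⟨Finset.mem_univ _,
    (Finset.univ.filter fun i => v i ≠ 0).min' hne, ?_, fun j hj => ?_⟩⟩
  · simp [hi]
  · have : v j = 0 := by
      by_contra h
      exact absurd (Finset.min'_le _ j (by simpa using h)) (not_le.2 hj)
    simp [this]

theorem eq_one_of_smul_mem_projPoints {F : Type*} [Field F] [Fintype F] [DecidableEq F] {m : ℕ}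
    {v : Fin m → F} {c : F} (hc : c ≠ 0) (hv : v ∈ projPoints F m)
    (hcv : c • v ∈ projPoints F m) : c = 1 := by
  obtain ⟨-, i, hi, hi'⟩ := Finset.mem_filter.1 hv
  obtain ⟨-, j, hj, hj'⟩ := Finset.mem_filter.1 hcv
  have hij : i = j := by
    rcases lt_trichotomy i j with h | h | h
    · have := hj' i h
      simp [hi, hc] at this
    · exact h
    · simp [hi' j h] at hj
  subst hij
  simpa [hi] using hj

theorem ne_zero_of_mem_projPoints {F : Type*} [Field F] [Fintype F] [DecidableEq F] {m : ℕ}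
    {v : Fin m → F} (hv : v ∈ projPoints F m) : v ≠ 0 := by
  obtain ⟨-, i, hi, -⟩ := Finset.mem_filter.1 hv
  rintro rfl
  simp at hi

/-- A set of nonzero vectors closed under scaling has `q - 1` vectors on each of its projective
points. -/
theorem card_units_mul_card_inter_projPoints {F : Type*} [Field F] [Fintype F] [DecidableEq F]
    {m : ℕ} (S : Finset (Fin m → F)) (h0 : 0 ∉ S) (hS : ∀ c : F, c ≠ 0 → ∀ v ∈ S, c • v ∈ S) :
    (Fintype.card F - 1) * (S ∩ projPoints F m).card = S.card := by
  rw [← Fintype.card_units, ← Finset.card_univ, ← Finset.card_product]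
  refine Finset.card_bij (fun p _ => (p.1 : F) • p.2) ?_ ?_ ?_
  · intro p hp
    exact hS _ p.1.ne_zero _ (Finset.mem_inter.1 (Finset.mem_product.1 hp).2).1
  · rintro ⟨a, v⟩ hp ⟨b, w⟩ hp' h
    have hv := (Finset.mem_inter.1 (Finset.mem_product.1 hp).2).2
    have hw := (Finset.mem_inter.1 (Finset.mem_product.1 hp').2).2
    simp only at h hv hw
    have h1 : w = ((b⁻¹ * a : Fˣ) : F) • v := by
      rw [Units.val_mul, mul_smul, h, smul_smul, ← Units.val_mul, inv_mul_cancel, Units.val_one,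
        one_smul]
    have h2 := eq_one_of_smul_mem_projPoints (Units.ne_zero _) hv (h1 ▸ hw)
    rw [h2, one_smul] at h1
    rw [Units.val_eq_one, inv_mul_eq_one] at h2
    rw [h1, h2]
  · intro v hv
    obtain ⟨c, hc, hcv⟩ := exists_smul_mem_projPoints (v := v) fun h => h0 (h ▸ hv)
    refine ⟨((Units.mk0 c hc)⁻¹, c • v), ?_, ?_⟩
    · simp [hcv, hS c hc v hv]
    · simp [smul_smul, hc]

/-- The vectors of `F ^ m` that vanish outside `A`. -/
def supportedOn (F : Type*) [Field F] [Fintype F] [DecidableEq F] {m : ℕ} (A : Finset (Fin m)) :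
    Finset (Fin m → F) :=
  Finset.univ.filter fun v => ∀ j, j ∉ A → v j = 0

theorem mem_supportedOn {F : Type*} [Field F] [Fintype F] [DecidableEq F] {m : ℕ}
    {A : Finset (Fin m)} {v : Fin m → F} : v ∈ supportedOn F A ↔ ∀ j, j ∉ A → v j = 0 := by
  simp [supportedOn]

theorem mem_subPoints {F : Type*} [Field F] [Fintype F] [DecidableEq F] {m : ℕ}
    {A : Finset (Fin m)} {v : Fin m → F} :
    v ∈ subPoints F A ↔ v ∈ projPoints F m ∧ v ∈ supportedOn F A := by
  simp [subPoints, supportedOn]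

theorem smul_mem_supportedOn {F : Type*} [Field F] [Fintype F] [DecidableEq F] {m : ℕ}
    {A : Finset (Fin m)} {v : Fin m → F} (c : F) (hv : v ∈ supportedOn F A) :
    c • v ∈ supportedOn F A :=
  mem_supportedOn.2 fun j hj => by simp [mem_supportedOn.1 hv j hj]

theorem card_supportedOn {F : Type*} [Field F] [Fintype F] [DecidableEq F] {m : ℕ}
    (A : Finset (Fin m)) : (supportedOn F A).card = Fintype.card F ^ A.card := by
  have : supportedOn F A =
      Fintype.piFinset fun j => if j ∈ A then (Finset.univ : Finset F) else {0} := by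
    ext v
    simp only [mem_supportedOn, Fintype.mem_piFinset]
    refine forall_congr' fun j => ?_
    by_cases hj : j ∈ A <;> simp [hj]
  rw [this, Fintype.card_piFinset]
  have h : ∀ j, (if j ∈ A then (Finset.univ : Finset F) else {0}).card =
      if j ∈ A then Fintype.card F else 1 := by
    intro j; by_cases hj : j ∈ A <;> simp [hj]
  simp [h]

theorem card_supportedOn_dotProduct_eq_zero {F : Type*} [Field F] [Fintype F] [DecidableEq F]
    {m : ℕ} {A : Finset (Fin m)} {x : Fin m → F} (hx : ∃ i ∈ A, x i ≠ 0) :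
    ((supportedOn F A).filter fun v => x ⬝ᵥ v = 0).card = Fintype.card F ^ (A.card - 1) := by
  obtain ⟨i, hiA, hi⟩ := hx
  rw [← Finset.card_erase_of_mem hiA, ← card_supportedOn]
  symm
  -- The `i`-th coordinate is determined by the others.
  refine Finset.card_bij (fun w _ => w - ((x ⬝ᵥ w) / x i) • Pi.single i 1) ?_ ?_ ?_
  · intro w hw
    rw [mem_supportedOn] at hw
    refine Finset.mem_filter.2 ⟨mem_supportedOn.2 fun j hj => ?_, ?_⟩
    · have hji : j ≠ i := fun h => hj (h ▸ hiA)
      simp [hw j (by simp [hj]), hji]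
    · simp [dotProduct_sub, dotProduct_smul, hi]
  · intro v hv w hw h
    rw [mem_supportedOn] at hv hw
    funext j
    by_cases hj : j = i
    · subst hj
      rw [hv j (by simp), hw j (by simp)]
    · simpa [hj] using congrFun h j
  · intro v hv
    obtain ⟨hv, hxv⟩ := Finset.mem_filter.1 hv
    rw [mem_supportedOn] at hv
    refine ⟨v - v i • Pi.single i 1, mem_supportedOn.2 fun j hj => ?_, ?_⟩
    · by_cases hji : j = i
      · subst hji; simp
      · simp [hji, hv j fun h => hj (by simp [h, hji])]
    · simp [dotProduct_sub, dotProduct_smul, hxv, neg_div, hi]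

/-- A functional that does not vanish on the subspace of dimension `a = |A|` vanishes off exactly
`q ^ (a - 1)` of its points. -/
theorem card_subPoints_dotProduct_ne_zero {F : Type*} [Field F] [Fintype F] [DecidableEq F]
    {m : ℕ} {A : Finset (Fin m)} {x : Fin m → F} (hx : ∃ i ∈ A, x i ≠ 0) :
    ((subPoints F A).filter fun v => x ⬝ᵥ v ≠ 0).card = Fintype.card F ^ (A.card - 1) := by
  have hA : 0 < A.card := Finset.card_pos.2 ⟨_, hx.choose_spec.1⟩
  have hq := Fintype.one_lt_card (α := F)
  have h1 := card_units_mul_card_inter_projPoints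
    ((supportedOn F A).filter fun v => x ⬝ᵥ v ≠ 0) (by simp) fun c hc v hv => by
      obtain ⟨h1, h2⟩ := Finset.mem_filter.1 hv
      exact Finset.mem_filter.2 ⟨smul_mem_supportedOn c h1, by simp [dotProduct_smul, hc, h2]⟩
  have h2 : ((supportedOn F A).filter fun v => x ⬝ᵥ v ≠ 0) ∩ projPoints F m =
      (subPoints F A).filter fun v => x ⬝ᵥ v ≠ 0 := by
    ext v
    simp only [Finset.mem_inter, Finset.mem_filter, mem_subPoints]
    tauto
  have h3 := Finset.card_filter_add_card_filter_not (s := supportedOn F A) fun v => x ⬝ᵥ v = 0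
  rw [card_supportedOn_dotProduct_eq_zero hx, card_supportedOn] at h3
  rw [h2] at h1
  obtain ⟨n, hn⟩ : ∃ n, Fintype.card F = n + 2 := ⟨_, (Nat.sub_add_cancel hq).symm⟩
  obtain ⟨a, ha⟩ : ∃ a, A.card = a + 1 := ⟨_, (Nat.sub_add_cancel hA).symm⟩
  simp only [ha, hn, Nat.add_sub_cancel, pow_succ] at h1 h3 ⊢
  rw [show n + 2 - 1 = n + 1 by omega] at h1
  refine Nat.eq_of_mul_eq_mul_left (show 0 < n + 1 by omega) ?_
  simp only [ne_eq] at h1 h3 ⊢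
  linarith

theorem card_subPoints_dotProduct_eq {F : Type*} [Field F] [Fintype F] [DecidableEq F]
    {m : ℕ} (A : Finset (Fin m)) (x : Fin m → F) :
    ((subPoints F A).filter fun v => x ⬝ᵥ v ≠ 0).card =
      if ∃ i ∈ A, x i ≠ 0 then Fintype.card F ^ (A.card - 1) else 0 := by
  split_ifs with h
  · exact card_subPoints_dotProduct_ne_zero h
  · push Not at h
    rw [Finset.card_eq_zero, Finset.filter_eq_empty_iff]
    intro v hv hne
    refine hne (Finset.sum_eq_zero fun i _ => ?_)
    by_cases hi : i ∈ A
    · rw [h i hi, zero_mul]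
    · rw [mem_supportedOn.1 (mem_subPoints.1 hv).2 i hi, mul_zero]

theorem card_subPoints {F : Type*} [Field F] [Fintype F] [DecidableEq F] {m : ℕ}
    (A : Finset (Fin m)) :
    (subPoints F A).card = ∑ j ∈ Finset.range A.card, Fintype.card F ^ j := by
  have hq := Fintype.one_lt_card (α := F)
  have h1 := card_units_mul_card_inter_projPoints ((supportedOn F A).erase 0) (by simp)
    fun c hc v hv => by
      obtain ⟨h1, h2⟩ := Finset.mem_erase.1 hv
      exact Finset.mem_erase.2 ⟨smul_ne_zero hc h1, smul_mem_supportedOn c h2⟩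
  have h2 : (supportedOn F A).erase 0 ∩ projPoints F m = subPoints F A := by
    ext v
    simp only [Finset.mem_inter, Finset.mem_erase, mem_subPoints]
    exact ⟨fun h => ⟨h.2, h.1.2⟩, fun h => ⟨⟨ne_zero_of_mem_projPoints h.1, h.2⟩, h.1⟩⟩
  rw [h2, Finset.card_erase_of_mem (mem_supportedOn.2 fun _ _ => Pi.zero_apply _), card_supportedOn] at h1
  rw [Nat.geomSum_eq hq, ← h1, Nat.mul_div_cancel_left _ (by omega)]

theorem subPoints_univ {F : Type*} [Field F] [Fintype F] [DecidableEq F] {m : ℕ} :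
    subPoints F (Finset.univ : Finset (Fin m)) = projPoints F m := by
  simp [subPoints]

theorem disjoint_subPoints {F : Type*} [Field F] [Fintype F] [DecidableEq F] {m : ℕ}
    {A B : Finset (Fin m)} (h : Disjoint A B) : Disjoint (subPoints F A) (subPoints F B) := by
  rw [Finset.disjoint_left]
  intro v hA hB
  refine ne_zero_of_mem_projPoints (mem_subPoints.1 hA).1 (funext fun j => ?_)
  by_cases hj : j ∈ A
  · exact mem_supportedOn.1 (mem_subPoints.1 hB).2 j (Finset.disjoint_left.1 h hj)
  · exact mem_supportedOn.1 (mem_subPoints.1 hA).2 j hj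

theorem card_complPoints_filter_add {F : Type*} [Field F] [Fintype F] [DecidableEq F] {m t : ℕ}
    {A : Fin t → Finset (Fin m)} (hdisj : ∀ i j, i ≠ j → Disjoint (A i) (A j))
    (P : (Fin m → F) → Prop) [DecidablePred P] :
    ((complPoints F A).filter P).card + ∑ i, ((subPoints F (A i)).filter P).card =
      ((projPoints F m).filter P).card := by
  have hsub : (Finset.univ.biUnion fun i => subPoints F (A i)) ⊆ projPoints F m :=
    Finset.biUnion_subset.2 fun i _ => Finset.filter_subset _ _
  rw [← Finset.card_biUnion fun i _ j _ hij =>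
      Finset.disjoint_filter_filter (disjoint_subPoints (hdisj i j hij)),
    ← Finset.filter_biUnion, complPoints, ← Finset.card_union_of_disjoint
      (Finset.disjoint_filter_filter Finset.sdiff_disjoint), ← Finset.filter_union,
    Finset.sdiff_union_of_subset hsub]

theorem card_complPoints_add {F : Type*} [Field F] [Fintype F] [DecidableEq F] {m t : ℕ}
    {A : Fin t → Finset (Fin m)} (hdisj : ∀ i j, i ≠ j → Disjoint (A i) (A j)) :
    (complPoints F A).card + ∑ i, ∑ j ∈ Finset.range (A i).card, Fintype.card F ^ j =
      ∑ j ∈ Finset.range m, Fintype.card F ^ j := by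
  have h := card_complPoints_filter_add (F := F) hdisj fun _ => True
  simp only [Finset.filter_true, ← subPoints_univ, card_subPoints, Finset.card_univ,
    Fintype.card_fin] at h
  exact h

/-! ### Weights of codewords -/

theorem hammingNorm_dotMap {F : Type*} [Field F] [DecidableEq F] {m : ℕ}
    (D : Finset (Fin m → F)) (x : Fin m → F) :
    hammingNorm (dotMap D x) = (D.filter fun v => x ⬝ᵥ v ≠ 0).card := by
  refine Finset.card_bij (fun j _ => (j : Fin m → F)) ?_ ?_ ?_
  · intro j hj; exact Finset.mem_filter.2 ⟨j.2, (Finset.mem_filter.1 hj).2⟩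
  · intro j _ j' _ h; exact Subtype.ext h
  · intro j hj
    have hj' := Finset.mem_filter.1 hj
    exact ⟨⟨j, hj'.1⟩, Finset.mem_filter.2 ⟨Finset.mem_univ _, hj'.2⟩, rfl⟩

/-- The weight of the codeword of `x` is `q ^ (m - 1)` minus the sum of `q ^ (a_i - 1)` over the
`A i` that meet the support of `x`. -/
theorem hammingNorm_dotMap_complPoints_add {F : Type*} [Field F] [Fintype F] [DecidableEq F]
    {m t : ℕ} {A : Fin t → Finset (Fin m)} (hdisj : ∀ i j, i ≠ j → Disjoint (A i) (A j))
    {x : Fin m → F} (hx : x ≠ 0) :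
    hammingNorm (dotMap (complPoints F A) x) +
      ∑ i, (if ∃ j ∈ A i, x j ≠ 0 then Fintype.card F ^ ((A i).card - 1) else 0) =
      Fintype.card F ^ (m - 1) := by
  have h := card_complPoints_filter_add (F := F) hdisj fun v => x ⬝ᵥ v ≠ 0
  have hx' : ∃ i ∈ (Finset.univ : Finset (Fin m)), x i ≠ 0 := by
    simpa using Function.ne_iff.1 hx
  rw [← subPoints_univ, card_subPoints_dotProduct_ne_zero hx', Finset.card_univ,
    Fintype.card_fin] at h
  simp only [card_subPoints_dotProduct_eq] at h
  rw [hammingNorm_dotMap, h]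

/-! ### Repair sets from lines -/

/-- The `q + 1` points `y` and `p + β y` of the line through `p` and `y`, indexed by
`Option F`, with `none` for `y` (not normalized). -/
def linePoint {F : Type*} [Field F] {m : ℕ} (p y : Fin m → F) : Option F → (Fin m → F)
  | none => y
  | some β => p + β • y

theorem linePoint_ne_zero {F : Type*} [Field F] {m : ℕ} {p y : Fin m → F}
    (hpy : LinearIndependent F ![p, y]) (k : Option F) : linePoint p y k ≠ 0 := by
  rw [LinearIndependent.pair_iff] at hpy
  intro h
  cases k with
  | none => simpa using (hpy 0 1 (by simpa [linePoint] using h)).2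
  | some β => simpa using (hpy 1 β (by simpa [linePoint] using h)).1

theorem linePoint_smul_injective {F : Type*} [Field F] {m : ℕ} {p y : Fin m → F}
    (hpy : LinearIndependent F ![p, y]) {k k' : Option F} {c c' : F} (hc : c ≠ 0) (hc' : c' ≠ 0)
    (h : c • linePoint p y k = c' • linePoint p y k') : k = k' := by
  rw [LinearIndependent.pair_iff] at hpy
  rcases k with _ | β <;> rcases k' with _ | β' <;> simp only [linePoint] at h
  · rfl
  · refine absurd (hpy (-c') (c - c' * β') ?_).1 (neg_ne_zero.2 hc')
    rw [← sub_eq_zero.2 h]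
    module
  · refine absurd (hpy c (c * β - c') ?_).1 hc
    rw [← sub_eq_zero.2 h]
    module
  · obtain ⟨h1, h2⟩ := hpy (c - c') (c * β - c' * β') (by
      rw [← sub_eq_zero.2 h]
      module)
    rw [sub_eq_zero] at h1
    rw [← h1, ← mul_sub, mul_eq_zero, sub_eq_zero] at h2
    rw [h2.resolve_left hc]

/-- A functional vanishing at two points of a line vanishes on the line. -/
theorem dotProduct_linePoint_eq_zero {F : Type*} [Field F] {m : ℕ} {p y x : Fin m → F}
    {k k' : Option F} (hk : k ≠ k') (h : x ⬝ᵥ linePoint p y k = 0)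
    (h' : x ⬝ᵥ linePoint p y k' = 0) (l : Option F) : x ⬝ᵥ linePoint p y l = 0 := by
  have key : x ⬝ᵥ p = 0 ∧ x ⬝ᵥ y = 0 := by
    rcases k with _ | β <;> rcases k' with _ | β' <;>
      simp only [linePoint, dotProduct_add, dotProduct_smul, smul_eq_mul] at h h'
    · exact absurd rfl hk
    · exact ⟨by simpa [h] using h', h⟩
    · exact ⟨by simpa [h'] using h, h'⟩
    · have h1 : (β - β') * x ⬝ᵥ y = 0 := by linear_combination h - h'
      have h2 := (mul_eq_zero.1 h1).resolve_left fun h0 => hk (by rw [sub_eq_zero.1 h0])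
      exact ⟨by simpa [h2] using h, h2⟩
  cases l <;> simp [linePoint, key.1, key.2]

/-- If some points of a line lie in `D`, the code restricted to them has minimum distance at least
their number minus one. The points are picked out by the index map `φ`. -/
theorem exists_repair_set {F : Type*} [Field F] [Fintype F] [DecidableEq F] {m : ℕ}
    {D : Finset (Fin m → F)} {p y : Fin m → F} (hpy : LinearIndependent F ![p, y])
    {κ : Type*} [Fintype κ] {φ : κ → Option F} (hφ : Function.Injective φ)
    (hD : ∀ k, ∀ c : F, c ≠ 0 → c • linePoint p y (φ k) ∈ projPoints F m →
      c • linePoint p y (φ k) ∈ D)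
    {k₀ : κ} (hk₀ : φ k₀ = some 0) (hpD : p ∈ D) (hp : p ∈ projPoints F m) :
    ∃ R : Finset D, ⟨p, hpD⟩ ∈ R ∧ R.card ≤ Fintype.card κ ∧
      ((Fintype.card κ - 1 : ℕ) : ℕ∞) ≤ minDist (restrictCode (codeOf D) R) := by
  classical
  choose c hc0 hc using fun k => exists_smul_mem_projPoints (linePoint_ne_zero hpy (φ k))
  let g : κ → D := fun k => ⟨c k • linePoint p y (φ k), hD k _ (hc0 k) (hc k)⟩
  have hg : Function.Injective g := fun k k' h =>
    hφ (linePoint_smul_injective hpy (hc0 k) (hc0 k') (congrArg Subtype.val h))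
  refine ⟨Finset.univ.image g, ?_, Finset.card_image_le, le_minDist_iff.2 ?_⟩
  · refine Finset.mem_image.2 ⟨k₀, Finset.mem_univ _, Subtype.ext ?_⟩
    have h1 : linePoint p y (φ k₀) = p := by simp [hk₀, linePoint]
    have h2 := hc k₀
    rw [h1] at h2
    change c k₀ • linePoint p y (φ k₀) = p
    rw [h1, eq_one_of_smul_mem_projPoints (hc0 k₀) hp h2, one_smul]
  · rintro _ ⟨_, ⟨x, rfl⟩, rfl⟩ hne
    -- The word vanishes at no more than one of the points.
    have hzero : (Finset.univ.filter fun k => x ⬝ᵥ linePoint p y (φ k) = 0).card ≤ 1 := by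
      rw [Finset.card_le_one]
      intro k hk k' hk'
      by_contra hkk
      refine hne (funext fun r => ?_)
      obtain ⟨l, -, hl⟩ := Finset.mem_image.1 r.2
      have := dotProduct_linePoint_eq_zero (hφ.ne hkk) (Finset.mem_filter.1 hk).2
        (Finset.mem_filter.1 hk').2 (φ l)
      change x ⬝ᵥ (r : D).1 = 0
      rw [← hl]
      simp [g, dotProduct_smul, this]
    have hcompl := Finset.card_filter_add_card_filter_not (s := (Finset.univ : Finset κ))
      fun k => x ⬝ᵥ linePoint p y (φ k) = 0
    have hle : (Finset.univ.filter fun k => ¬ x ⬝ᵥ linePoint p y (φ k) = 0).card ≤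
        hammingNorm (LinearMap.funLeft F F
          (Subtype.val : {r // r ∈ Finset.univ.image g} → D) (dotMap D x)) := by
      refine Finset.card_le_card_of_injOn
        (fun k => ⟨g k, Finset.mem_image_of_mem _ (Finset.mem_univ k)⟩) ?_ ?_
      · intro k hk
        have hk' := (Finset.mem_filter.1 hk).2
        refine Finset.mem_filter.2 ⟨Finset.mem_univ _, ?_⟩
        change x ⬝ᵥ (c k • linePoint p y (φ k)) ≠ 0
        simp [dotProduct_smul, hc0 k, hk']
      · intro k _ k' _ h
        exact hg (congrArg Subtype.val h)
    rw [Finset.card_univ] at hcompl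
    omega

/-- Outside the union of the subspaces spanned by `p` and the vectors supported on `B i` there is
a nonzero vector, when those subspaces have too few nonzero vectors to cover `F ^ m`. -/
theorem exists_notMem_span_supportedOn {F : Type*} [Field F] [Fintype F] [DecidableEq F] {m : ℕ}
    {κ : Type*} [Fintype κ] (B : κ → Finset (Fin m)) (p : Fin m → F)
    (h : ∑ i, (Fintype.card F ^ ((B i).card + 1) - 1) < Fintype.card F ^ m - 1) :
    ∃ y : Fin m → F, y ≠ 0 ∧ ∀ i, ∀ u ∈ supportedOn F (B i), ∀ β : F, y ≠ u + β • p := by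
  classical
  let W : κ → Finset (Fin m → F) := fun i =>
    (supportedOn F (B i) ×ˢ (Finset.univ : Finset F)).image fun z => z.1 + z.2 • p
  have hW : ∀ i, ((W i).erase 0).card ≤ Fintype.card F ^ ((B i).card + 1) - 1 := by
    intro i
    have h0 : (0 : Fin m → F) ∈ W i :=
      Finset.mem_image.2 ⟨(0, 0), by simp [mem_supportedOn], by simp⟩
    rw [Finset.card_erase_of_mem h0]
    refine Nat.sub_le_sub_right (Finset.card_image_le.trans ?_) 1
    rw [Finset.card_product, card_supportedOn, Finset.card_univ, pow_succ]
  have hlt : (Finset.univ.biUnion fun i => (W i).erase 0).card <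
      ((Finset.univ : Finset (Fin m → F)).erase 0).card := by
    refine (Finset.card_biUnion_le.trans (Finset.sum_le_sum fun i _ => hW i)).trans_lt ?_
    rw [Finset.card_erase_of_mem (Finset.mem_univ _), Finset.card_univ]
    simpa using h
  obtain ⟨y, hy, hy'⟩ := Finset.exists_mem_notMem_of_card_lt_card hlt
  have hy0 := (Finset.mem_erase.1 hy).1
  refine ⟨y, hy0, fun i u hu β hyu => hy' ?_⟩
  exact Finset.mem_biUnion.2 ⟨i, Finset.mem_univ _, Finset.mem_erase.2 ⟨hy0,
    Finset.mem_image.2 ⟨(u, β), by simp [hu], hyu.symm⟩⟩⟩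

theorem mem_complPoints {F : Type*} [Field F] [Fintype F] [DecidableEq F] {m t : ℕ}
    {A : Fin t → Finset (Fin m)} {v : Fin m → F} :
    v ∈ complPoints F A ↔ v ∈ projPoints F m ∧ ∀ i, v ∉ supportedOn F (A i) := by
  simp only [complPoints, Finset.mem_sdiff, Finset.mem_biUnion, Finset.mem_univ, true_and,
    mem_subPoints, not_exists, not_and]
  exact and_congr_right fun h => forall_congr' fun i => ⟨fun h' => h' h, fun h' _ => h'⟩

theorem linePoint_some_notMem_supportedOn {F : Type*} [Field F] [Fintype F] [DecidableEq F]
    {m : ℕ} {B : Finset (Fin m)} {p y : Fin m → F} (hp : p ∉ supportedOn F B)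
    (hy : ∀ u ∈ supportedOn F B, ∀ β : F, y ≠ u + β • p) (β : F) :
    linePoint p y (some β) ∉ supportedOn F B := by
  intro h
  by_cases hβ : β = 0
  · exact hp (by simpa [linePoint, hβ] using h)
  · refine hy _ (smul_mem_supportedOn β⁻¹ h) (-β⁻¹) ?_
    simp [linePoint, smul_smul, hβ]

theorem linearIndependent_of_forall_ne {F : Type*} [Field F] [Fintype F] [DecidableEq F]
    {m : ℕ} {B : Finset (Fin m)} {p y : Fin m → F} (hp : p ≠ 0)
    (hy : ∀ u ∈ supportedOn F B, ∀ β : F, y ≠ u + β • p) : LinearIndependent F ![p, y] := by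
  rw [LinearIndependent.pair_iff' hp]
  intro a ha
  exact hy 0 (mem_supportedOn.2 fun _ _ => rfl) a (by rw [ha, zero_add])

theorem smul_notMem_supportedOn {F : Type*} [Field F] [Fintype F] [DecidableEq F] {m : ℕ}
    {A : Finset (Fin m)} {v : Fin m → F} {c : F} (hc : c ≠ 0) (hv : v ∉ supportedOn F A) :
    c • v ∉ supportedOn F A := fun h => hv (by
  have := smul_mem_supportedOn c⁻¹ h
  rwa [smul_smul, inv_mul_cancel₀ hc, one_smul] at this)

/-- Every point outside `D` lies on a line that misses `D`, provided that `D` is small; the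
points of this line form a repair set. -/
theorem isLRC_complPoints_of_sum_lt {F : Type*} [Field F] [Fintype F] [DecidableEq F] {m t : ℕ}
    {A : Fin t → Finset (Fin m)} (ht : 0 < t)
    (h : ∑ i, (Fintype.card F ^ ((A i).card + 1) - 1) < Fintype.card F ^ m - 1) :
    IsLRC 2 (Fintype.card F) (codeOf (complPoints F A)) := by
  rintro ⟨p, hpD⟩
  obtain ⟨hp, hpA⟩ := mem_complPoints.1 hpD
  obtain ⟨y, -, hy⟩ := exists_notMem_span_supportedOn A p h
  have hpy := linearIndependent_of_forall_ne (ne_zero_of_mem_projPoints hp) (hy ⟨0, ht⟩)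
  have hline : ∀ k i, linePoint p y k ∉ supportedOn F (A i) := by
    intro k i
    cases k with
    | none => exact fun hmem => hy i y hmem 0 (by simp)
    | some β => exact linePoint_some_notMem_supportedOn (hpA i) (hy i) β
  obtain ⟨R, h1, h2, h3⟩ := exists_repair_set (D := complPoints F A) hpy
    (φ := fun k : Option F => k) (fun _ _ h => h) (fun k c hc hcp => mem_complPoints.2 ⟨hcp,
      fun i => smul_notMem_supportedOn hc (hline k i)⟩) (k₀ := some 0) rfl hpD hp
  rw [Fintype.card_option] at h2 h3
  exact ⟨R, h1, by omega, by simpa using h3⟩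

/-- When one of the two subspaces is a hyperplane and the other a point, a line through a point
`p` outside both that avoids the second meets the first in a single point; its other `q` points
form a repair set. -/
theorem isLRC_complPoints_of_hyperplane {F : Type*} [Field F] [Fintype F] [DecidableEq F]
    {m t : ℕ} (hm : 2 < m) {A : Fin t → Finset (Fin m)} {i₀ i₁ : Fin t}
    (hi : ∀ i, i = i₀ ∨ i = i₁) (h₀ : (A i₀).card = m - 1) (h₁ : (A i₁).card ≤ 1) :
    IsLRC 2 (Fintype.card F - 1) (codeOf (complPoints F A)) := by
  have hq := Fintype.one_lt_card (α := F)
  rintro ⟨p, hpD⟩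
  obtain ⟨hp, hpA⟩ := mem_complPoints.1 hpD
  obtain ⟨k, hk⟩ : ∃ k, (A i₀)ᶜ = {k} := Finset.card_eq_one.1 (by
    rw [Finset.card_compl, h₀, Fintype.card_fin]; omega)
  have hmem : ∀ v : Fin m → F, v ∈ supportedOn F (A i₀) ↔ v k = 0 := by
    intro v
    simp only [mem_supportedOn, ← Finset.mem_compl, hk, Finset.mem_singleton, forall_eq]
  have hpk : p k ≠ 0 := fun h => hpA i₀ ((hmem p).2 h)
  obtain ⟨z, -, hz⟩ := exists_notMem_span_supportedOn (fun _ : Unit => A i₁) p (by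
    have h2 : Fintype.card F ^ ((A i₁).card + 1) ≤ Fintype.card F ^ 2 :=
      Nat.pow_le_pow_right (by omega) (by omega)
    have h3 : Fintype.card F ^ 2 < Fintype.card F ^ m := Nat.pow_lt_pow_right hq hm
    have h4 : 0 < Fintype.card F ^ 2 := by positivity
    simp only [Finset.univ_unique, Finset.sum_const, Finset.card_singleton, one_smul]
    omega)
  -- Move `z` along `p` into the hyperplane.
  obtain ⟨y, hy⟩ : ∃ y, y = z - (z k / p k) • p := ⟨_, rfl⟩
  have hyk : y k = 0 := by simp [hy, hpk]
  have hy₁ : ∀ u ∈ supportedOn F (A i₁), ∀ β : F, y ≠ u + β • p := by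
    intro u hu β h
    refine hz () u hu (β + z k / p k) ?_
    rw [add_smul, ← add_assoc, ← h, hy, sub_add_cancel]
  have hpy := linearIndependent_of_forall_ne (ne_zero_of_mem_projPoints hp) hy₁
  have hline : ∀ β i, linePoint p y (some β) ∉ supportedOn F (A i) := by
    intro β i
    rcases hi i with rfl | rfl
    · rw [hmem]
      simpa [linePoint, hyk] using hpk
    · exact linePoint_some_notMem_supportedOn (hpA _) hy₁ β
  obtain ⟨R, h1, h2, h3⟩ := exists_repair_set (D := complPoints F A) hpy
    (φ := fun β : F => some β) (Option.some_injective F)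
    (fun β c hc hcp => mem_complPoints.2
      ⟨hcp, fun i => smul_notMem_supportedOn hc (hline β i)⟩)
    (k₀ := 0) rfl hpD hp
  exact ⟨R, h1, by omega, h3⟩

/-! ### Dimension, minimum distance and optimality -/

/-- If no cardinality occurs more than `q - 1` times, the sum of the `q ^ (a_i - 1)` with
`a_i ≤ j` is bounded by a number with all base-`q` digits `q - 1`. -/
theorem sum_pow_card_lt {F : Type*} [Fintype F] [Nonempty F] {κ : Type*} [Fintype κ]
    {a : κ → ℕ} (ha : ∀ i, 0 < a i)
    (h : ∀ b : ℕ, (Finset.univ.filter fun i => a i = b).card ≤ Fintype.card F - 1) (j : ℕ) :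
    ∑ i with a i ≤ j, Fintype.card F ^ (a i - 1) < Fintype.card F ^ j := by
  classical
  induction j with
  | zero =>
    rw [Finset.filter_eq_empty_iff.2 fun i _ => by have := ha i; omega]
    simp
  | succ j ih =>
    have hsplit : (Finset.univ.filter fun i => a i ≤ j + 1) =
        (Finset.univ.filter fun i => a i ≤ j) ∪ Finset.univ.filter fun i => a i = j + 1 := by
      ext i; simp [Nat.le_succ_iff]
    have h1 : ∑ i with a i = j + 1, Fintype.card F ^ (a i - 1) =
        (Finset.univ.filter fun i => a i = j + 1).card * Fintype.card F ^ j := by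
      rw [Finset.sum_congr rfl fun i hi => by rw [(Finset.mem_filter.1 hi).2, Nat.add_sub_cancel],
        Finset.sum_const, smul_eq_mul]
    rw [hsplit, Finset.sum_union (Finset.disjoint_filter.2 fun i _ h h' => by omega), h1]
    obtain ⟨n, hn⟩ : ∃ n, Fintype.card F = n + 1 :=
      ⟨_, (Nat.succ_pred Fintype.card_ne_zero).symm⟩
    have h2 := Nat.mul_le_mul_right (Fintype.card F ^ j) (h (j + 1))
    rw [hn] at ih h2 ⊢
    rw [Nat.add_sub_cancel] at h2
    rw [pow_succ]
    linarith

theorem sum_card_le_of_disjoint {m t : ℕ} {A : Fin t → Finset (Fin m)}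
    (hdisj : ∀ i j, i ≠ j → Disjoint (A i) (A j)) : ∑ i, (A i).card ≤ m := by
  rw [← Finset.card_biUnion fun i _ j _ hij => hdisj i j hij]
  simpa using Finset.card_le_univ (Finset.univ.biUnion A)

/-- The codewords of the code of `D^c` come from distinct vectors, and the vector `(1, …, 1)`
gives a codeword of least weight. -/
theorem finrank_minDist_codeOf_complPoints {F : Type*} [Field F] [Fintype F] [DecidableEq F]
    {m t : ℕ} {A : Fin t → Finset (Fin m)} (hm : 0 < m) (hne : ∀ i, (A i).Nonempty)
    (hdisj : ∀ i j, i ≠ j → Disjoint (A i) (A j)) {d : ℕ} (hd0 : 0 < d)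
    (hd : d + ∑ i, Fintype.card F ^ ((A i).card - 1) = Fintype.card F ^ (m - 1)) :
    Module.finrank F (codeOf (complPoints F A)) = m ∧
      minDist (codeOf (complPoints F A)) = d := by
  have hle : ∀ x : Fin m → F, x ≠ 0 → d ≤ hammingNorm (dotMap (complPoints F A) x) := by
    intro x hx
    have h1 := hammingNorm_dotMap_complPoints_add (F := F) hdisj hx
    have h2 : ∑ i, (if ∃ j ∈ A i, x j ≠ 0 then Fintype.card F ^ ((A i).card - 1) else 0) ≤
        ∑ i, Fintype.card F ^ ((A i).card - 1) :=
      Finset.sum_le_sum fun i _ => by split_ifs <;> simp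
    omega
  have hinj : Function.Injective (dotMap (complPoints F A)) := by
    rw [injective_iff_map_eq_zero]
    intro x hx
    by_contra hx0
    have := hle x hx0
    rw [hx, hammingNorm_zero] at this
    omega
  refine ⟨?_, ?_⟩
  · rw [codeOf, LinearMap.finrank_range_of_inj hinj, Module.finrank_fin_fun]
  · have hone : (fun _ => 1 : Fin m → F) ≠ 0 := fun h => one_ne_zero (congrFun h ⟨0, hm⟩)
    refine minDist_eq_of_forall_le (c := dotMap (complPoints F A) fun _ => 1) ?_ ⟨_, rfl⟩ ?_ ?_
    · rintro _ ⟨x, rfl⟩ h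
      exact hle x fun hx => h (by simp [hx])
    · exact fun h => hone (hinj (by rw [h, map_zero]))
    · have h1 := hammingNorm_dotMap_complPoints_add (F := F) hdisj hone
      rw [Finset.sum_congr rfl fun i _ => if_pos ?_] at h1
      · omega
      · obtain ⟨j, hj⟩ := hne i
        exact ⟨j, hj, one_ne_zero⟩

/-- The code of `D^c` meets the Griesmer bound with defect at most `∑ ε j ≤ 1`. Hence a code with
the same minimum distance and dimension `m - 1` is at most two coordinates shorter, and taking off
one repair set forces the dimension down to `m - 2`. -/
theorem isKOptimalLRC_complPoints {F : Type*} [Field F] [Fintype F] [DecidableEq F]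
    {m t δ : ℕ} {A : Fin t → Finset (Fin m)} (hm : 2 < m) (hne : ∀ i, (A i).Nonempty)
    (hdisj : ∀ i j, i ≠ j → Disjoint (A i) (A j)) (hA : ∀ i, (A i).card ≤ m - 1)
    (hδ : 2 ≤ δ) (hLRC : IsLRC 2 δ (codeOf (complPoints F A)))
    (ε : ℕ → ℕ) (hε : ∑ j ∈ Finset.range (m - 1), ε j ≤ 1) (hε' : ε (m - 1) = 0)
    (h : ∀ j, ∑ i with (A i).card ≤ j, Fintype.card F ^ ((A i).card - 1) <
      Fintype.card F ^ j * (1 + ε j)) :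
    IsKOptimalLRC 2 δ (codeOf (complPoints F A)) := by
  have hlast := h (m - 1)
  rw [hε', Finset.filter_true_of_mem fun i _ => hA i] at hlast
  obtain ⟨d, hd⟩ : ∃ d, d + ∑ i, Fintype.card F ^ ((A i).card - 1) = Fintype.card F ^ (m - 1) :=
    ⟨_, Nat.sub_add_cancel (by omega)⟩
  have hd0 : 0 < d := by omega
  obtain ⟨hrank, hdist⟩ := finrank_minDist_codeOf_complPoints (by omega) hne hdisj hd0 hd
  refine isKOptimalLRC_of_kOpt_le (by omega) hLRC hd0 hdist ?_
  have hlen := card_complPoints_add (F := F) hdisj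
  have hmn : m ≤ (complPoints F A).card := by
    have := Submodule.finrank_le (codeOf (complPoints F A))
    rw [hrank] at this
    simpa using this
  have hcard : Fintype.card (complPoints F A) = (complPoints F A).card := Fintype.card_coe _
  suffices hk : kOpt F ((complPoints F A).card - (2 + δ - 1)) d ≤ m - 2 by
    rw [hrank, hcard]; omega
  refine csSup_le' ?_
  rintro k ⟨C, hC, rfl⟩
  by_contra! hlt
  -- Apart from `ε j`, this is `d / q ^ j` with the terms of exponent below `j` dropped.
  let e : ℕ → ℤ := fun j => (Fintype.card F : ℤ) ^ (m - 1 - j) -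
    (∑ i, if j < (A i).card then (Fintype.card F : ℤ) ^ ((A i).card - 1 - j) else 0) - ε j
  have hG := griesmer_bound (m - 1) C Finset.univ d e (by omega)
    (le_minDist_iff.1 hC.ge) (by
      intro j hj
      have hdZ : (d : ℤ) = (Fintype.card F : ℤ) ^ (m - 1) -
          ∑ i, (Fintype.card F : ℤ) ^ ((A i).card - 1) := by
        rw [eq_sub_iff_add_eq]; exact_mod_cast hd
      have hjZ : ∑ i with (A i).card ≤ j, (Fintype.card F : ℤ) ^ ((A i).card - 1) <
          (Fintype.card F : ℤ) ^ j * (1 + ε j) := by exact_mod_cast h j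
      have hsplit := Finset.sum_filter_add_sum_filter_not Finset.univ
        (fun i => (A i).card ≤ j) fun i => (Fintype.card F : ℤ) ^ ((A i).card - 1)
      have hmul : (Fintype.card F : ℤ) ^ j *
          (∑ i, if j < (A i).card then (Fintype.card F : ℤ) ^ ((A i).card - 1 - j) else 0) =
          ∑ i with ¬ (A i).card ≤ j, (Fintype.card F : ℤ) ^ ((A i).card - 1) := by
        rw [Finset.mul_sum, Finset.sum_filter]
        refine Finset.sum_congr rfl fun i _ => ?_
        by_cases hij : j < (A i).card
        · rw [if_pos hij, if_pos (not_le.2 hij), ← pow_add]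
          congr 1; omega
        · rw [if_neg hij, if_neg (by simpa using hij), mul_zero]
      have hpow : (Fintype.card F : ℤ) ^ j * (Fintype.card F : ℤ) ^ (m - 1 - j) =
          (Fintype.card F : ℤ) ^ (m - 1) := by
        rw [← pow_add]; congr 1; omega
      simp only [e]
      rw [mul_sub, mul_sub, hmul, hpow]
      linarith)
  have hsum : ∑ j ∈ Finset.range (m - 1), e j =
      ((complPoints F A).card : ℤ) - 1 - ∑ j ∈ Finset.range (m - 1), (ε j : ℤ) := by
    simp only [e]
    rw [Finset.sum_sub_distrib, Finset.sum_sub_distrib, Finset.sum_comm]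
    have h1 : ∑ j ∈ Finset.range (m - 1), (Fintype.card F : ℤ) ^ (m - 1 - j) =
        ∑ j ∈ Finset.range m, (Fintype.card F : ℤ) ^ j - 1 := by
      obtain ⟨n, rfl⟩ : ∃ n, m = n + 1 := ⟨m - 1, by omega⟩
      rw [Finset.sum_range_succ' _ n, pow_zero, add_sub_cancel_right, Nat.add_sub_cancel,
        ← Finset.sum_range_reflect]
      refine Finset.sum_congr rfl fun j hj => ?_
      have := Finset.mem_range.1 hj
      congr 1; omega
    have h2 : ∀ i, ∑ j ∈ Finset.range (m - 1),
        (if j < (A i).card then (Fintype.card F : ℤ) ^ ((A i).card - 1 - j) else 0) =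
        ∑ j ∈ Finset.range (A i).card, (Fintype.card F : ℤ) ^ j := by
      intro i
      rw [← Finset.sum_filter, ← Finset.sum_range_reflect]
      refine Finset.sum_congr ?_ fun _ _ => rfl
      ext j
      have := hA i
      simp only [Finset.mem_filter, Finset.mem_range]
      omega
    rw [h1, Finset.sum_congr rfl fun i _ => h2 i]
    have hlenZ : ((complPoints F A).card : ℤ) +
        ∑ i, ∑ j ∈ Finset.range (A i).card, (Fintype.card F : ℤ) ^ j =
        ∑ j ∈ Finset.range m, (Fintype.card F : ℤ) ^ j := by exact_mod_cast hlen
    linarith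
  have hεZ : ∑ j ∈ Finset.range (m - 1), (ε j : ℤ) ≤ 1 := by exact_mod_cast hε
  rw [hsum, Finset.card_univ, Fintype.card_fin] at hG
  omega

theorem mainTheorem4 {F : Type*} [Field F] [Fintype F] [DecidableEq F]
    (m t : ℕ) (hm : 1 < m) (ht : 1 < t)
    (A : Fin t → Finset (Fin m))
    (hne : ∀ i, (A i).Nonempty)
    (hdisj : ∀ i j, i ≠ j → Disjoint (A i) (A j)) :
    (t = 2 → (∀ i, (A i).card ≤ m - 2) →
      IsKOptimalLRC 2 (Fintype.card F) (codeOf (complPoints F A))) ∧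
    (3 ≤ t → 4 ≤ m →
      (∀ a : ℕ, (Finset.univ.filter fun i => (A i).card = a).card ≤ Fintype.card F - 1) →
      IsKOptimalLRC 2 (Fintype.card F) (codeOf (complPoints F A))) ∧
    (t = 2 → 2 < m → 2 < Fintype.card F → (∃ i, (A i).card = m - 1) →
      IsKOptimalLRC 2 (Fintype.card F - 1) (codeOf (complPoints F A))) := by
  have hq := Fintype.one_lt_card (α := F)
  have hpos : ∀ i, 0 < (A i).card := fun i => Finset.card_pos.2 (hne i)
  have hsum := sum_card_le_of_disjoint hdisj
  -- Each of the other `t - 1` sets has an element.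
  have hcard : ∀ i, (A i).card + (t - 1) ≤ m := by
    intro i
    have h1 := Finset.card_nsmul_le_sum (Finset.univ.erase i) (fun j => (A j).card) 1
      fun j _ => hpos j
    rw [Finset.card_erase_of_mem (Finset.mem_univ i), Finset.card_univ, Fintype.card_fin] at h1
    have h2 := Finset.add_sum_erase Finset.univ (fun j => (A j).card) (Finset.mem_univ i)
    simp only [smul_eq_mul, mul_one] at h1 h2
    omega
  refine ⟨?_, ?_, ?_⟩
  · rintro rfl hA
    have hm2 : 2 < m := by have := hA 0; have := hpos 0; omega
    have hLRC : IsLRC 2 (Fintype.card F) (codeOf (complPoints F A)) := by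
      refine isLRC_complPoints_of_sum_lt two_pos ?_
      have hle : ∀ i, Fintype.card F ^ ((A i).card + 1) ≤ Fintype.card F ^ (m - 1) :=
        fun i => Nat.pow_le_pow_right (by omega) (by have := hA i; omega)
      have hm' : Fintype.card F ^ m = Fintype.card F ^ (m - 1) * Fintype.card F := by
        rw [← pow_succ]; congr 1; omega
      have h2 := Nat.mul_le_mul_left (Fintype.card F ^ (m - 1)) (show 2 ≤ Fintype.card F from hq)
      have h3 : 0 < Fintype.card F ^ (m - 1) := by positivity
      rw [Fin.sum_univ_two]
      have := hle 0
      have := hle 1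
      omega
    -- The defect `1` occurs only for `q = 2` and `|A 0| = |A 1|`, in the place `j = |A 0|`.
    refine isKOptimalLRC_complPoints hm2 hne hdisj (fun i => by have := hA i; omega) hq hLRC
      (fun j => if j = (A 0).card then 1 else 0) ?_ ?_ ?_
    · rw [Finset.sum_ite_eq']; split_ifs <;> omega
    · exact if_neg (by have := hA 0; omega)
    · intro j
      obtain ⟨q, hqdef⟩ : ∃ q, q = Fintype.card F := ⟨_, rfl⟩
      rw [← hqdef] at hq ⊢
      have hlt : ∀ i, (A i).card ≤ j → q ^ ((A i).card - 1) < q ^ j := fun i hi =>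
        Nat.pow_lt_pow_right hq (by have := hpos i; omega)
      rw [Finset.sum_filter, Fin.sum_univ_two]
      by_cases h0 : (A 0).card ≤ j
      · have hlt0 := hlt 0 h0
        by_cases h1 : (A 1).card ≤ j
        · have hlt1 := hlt 1 h1
          rw [if_pos h0, if_pos h1]
          split_ifs with hj
          · omega
          · obtain ⟨n, rfl⟩ : ∃ n, j = n + 2 := ⟨j - 2, by have := hpos 0; omega⟩
            have h2 : q ^ ((A 0).card - 1) ≤ q ^ n := Nat.pow_le_pow_right (by omega) (by omega)
            have h3 : q ^ ((A 1).card - 1) ≤ q ^ (n + 1) :=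
              Nat.pow_le_pow_right (by omega) (by omega)
            have h4 : 0 < q ^ n := by positivity
            have h5 : q ^ n * (1 + q) < q ^ n * (q * q) :=
              Nat.mul_lt_mul_of_pos_left (by nlinarith) h4
            have h6 : q ^ (n + 1) = q ^ n * q := pow_succ q n
            have h7 : q ^ (n + 2) = q ^ n * (q * q) := by ring
            rw [h7]
            linarith
        · rw [if_pos h0, if_neg h1, add_zero]
          exact hlt0.trans_le (Nat.le_mul_of_pos_right _ (by omega))
      · rw [if_neg h0, zero_add]
        have h4 : 0 < q ^ j := by positivity
        refine lt_of_lt_of_le ?_ (Nat.le_mul_of_pos_right _ (by omega))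
        split_ifs with h1
        · exact hlt 1 h1
        · exact h4
  · intro ht3 _ hmult
    have hA : ∀ i, (A i).card ≤ m - 2 := fun i => by have := hcard i; omega
    have hlt := sum_pow_card_lt (F := F) hpos hmult
    have hLRC : IsLRC 2 (Fintype.card F) (codeOf (complPoints F A)) := by
      refine isLRC_complPoints_of_sum_lt (by omega) ?_
      have h1 := hlt (m - 2)
      rw [Finset.filter_true_of_mem fun i _ => hA i] at h1
      have h2 : ∑ i, (Fintype.card F ^ ((A i).card + 1) - 1) + ∑ _i : Fin t, 1 =
          Fintype.card F ^ 2 * ∑ i, Fintype.card F ^ ((A i).card - 1) := by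
        rw [← Finset.sum_add_distrib, Finset.mul_sum]
        refine Finset.sum_congr rfl fun i _ => ?_
        rw [Nat.sub_add_cancel (Nat.one_le_pow _ _ (by omega)), ← pow_add]
        have := hpos i
        congr 1; omega
      have h4 : Fintype.card F ^ m = Fintype.card F ^ 2 * Fintype.card F ^ (m - 2) := by
        rw [← pow_add]; congr 1; omega
      have h5 := Nat.mul_lt_mul_of_pos_left h1 (show 0 < Fintype.card F ^ 2 by positivity)
      rw [Finset.sum_const, Finset.card_univ, Fintype.card_fin, smul_eq_mul, mul_one] at h2
      omega
    exact isKOptimalLRC_complPoints (by omega) hne hdisj (fun i => by have := hA i; omega) hq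
      hLRC (fun _ => 0) (by simp) rfl fun j => by simpa using hlt j
  · rintro rfl hm2 hq2 ⟨i₀, hi₀⟩
    obtain ⟨i₁, hi₁, hi⟩ : ∃ i₁, i₁ ≠ i₀ ∧ ∀ i, i = i₀ ∨ i = i₁ := by
      clear hi₀
      revert i₀
      decide
    have h₁ : (A i₁).card ≤ 1 := by
      have := Finset.card_le_univ (A i₀ ∪ A i₁)
      rw [Finset.card_union_of_disjoint (hdisj _ _ hi₁.symm), hi₀, Fintype.card_fin] at this
      omega
    have hlt := sum_pow_card_lt (F := F) hpos fun b =>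
      (Finset.card_le_univ _).trans (by rw [Fintype.card_fin]; omega)
    exact isKOptimalLRC_complPoints hm2 hne hdisj (fun i => by have := hcard i; omega) (by omega)
      (isLRC_complPoints_of_hyperplane hm2 hi hi₀ h₁) (fun _ => 0) (by simp) rfl
      fun j => by simpa using hlt j
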